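/- Let $k\ge 2$ and $n\ge 1$ be integers and work over $\mathbf C$. Let $J:\mathbf P^k\dashrightarrow\mathbf P^k$, $J[x_0:\dots:x_k]=x_0\cdots x_k\,[1/x_0:\dots:1/x_k]$, be the standard Cremona involution, let $\mathbf e_0,\dots,\mathbf e_k\in\mathbf P^k$ be the coordinate points, and let $C=\gamma(\mathbf C\cup\{\infty\})\subset\mathbf P^k$ be the cuspidal curve $\gamma(t)=[1:t:\dots:t^{k-1}:t^{k+1}]$, $\gamma(\infty)=[0:\dots:0:1]$. Let $S,T\in GL_{k+1}(\mathbf C)$ and let $F=S\circ J\circ T^{-1}$, with indeterminacy set $I(F)$. Assume: 1. $F$ properly fixes $C$ with multiplier $\delta$: every point $T(\mathbf e_j)$ lies on $\gamma(\mathbf C)$, and there are $\delta\in\mathbf C^*$, $\tau\in\mathbf C$ such that $F(\gamma(t))=\gamma(\delta t+\tau)$ for all $t\in\mathbf C\cup\{\infty\}$ with $\gamma(t)\notin I(F)$ (where $\delta\cdot\infty+\tau=\infty$). 2. $\delta$ is not a root of unity. 3. $F$ has orbit data $(1,\dots,1,n)$ with cyclic permutation: $S(\mathbf e_j)=T(\mathbf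 e_{j+1})$ for $0\le j\le k-1$, $F^{i}(S(\mathbf e_k))\notin I(F)$ for $0\le i<n-1$, and $F^{n-1}(S(\mathbf e_k))=T(\mathbf e_0)$. Put $\beta_i=\dfrac{\delta^i-1}{\delta(\delta^{k+1}-\delta^i)}$ for $1\le i\le k$, and let $L$ be the $(k+1)\times(k+1)$ matrix $$L=\begin{pmatrix}0&0&\cdots&0&1\\ \beta_1&0&\cdots&0&1-\beta_1\\ 0&\beta_2&\cdots&0&1-\beta_2\\ \vdots&&\ddots&&\vdots\\ 0&0&\cdots&\beta_k&1-\beta_k\end{pmatrix}.$$ Then: (a) $\delta$ is a root of $(\delta^{n+k}-1)(\delta^2-1)-\delta(\delta^{k+1}-1)(\delta^{n-1}-1)$. (b) There are $S',T'\in GL_{k+1}(\mathbf C)$ with $S'\circ J\circ T'^{-1}=F$, with $S'(\mathbf e_j)=S(\mathbf e_j)$ and $T'(\mathbf e_j)=T(\mathbf e_j)$ in $\mathbf P^k$ for all $j$, and with $S'[1:\dots:1]=T'[1:\dots:1]=\gamma(\infty)$, such that $T'^{-1}S'=L$; consequently $F$ is linearly conjugate to $L\circ J$, namely $T'^{-1}\circ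 F\circ T'=L\circ J$. (c) If already $T[1:\dots:1]=\gamma(\infty)$, then also $S[1:\dots:1]=\gamma(\infty)$, and $T^{-1}S$ is a non-zero scalar multiple of $L$. -/

import Mathlib

open scoped LinearAlgebra.Projectivization

noncomputable section

/-- Complex projective space `P^k`; an element of `GL (Fin (k + 1)) ℂ` acts on it by
`g • [v] = [g v]`. -/
abbrev ProjSpace (k : ℕ) : Type := ℙ ℂ (Fin (k + 1) → ℂ)

/-- The coordinate point `e_j = [0 : ⋯ : 0 : 1 : 0 : ⋯ : 0]`. -/
def basePoint (k : ℕ) (j : Fin (k + 1)) : ProjSpace k :=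
  Projectivization.mk ℂ (Pi.single j 1) (by simp)

/-- The point `[1 : ⋯ : 1]`. -/
def onesPoint (k : ℕ) : ProjSpace k :=
  Projectivization.mk ℂ (fun _ => 1) (fun h => one_ne_zero (congrFun h 0))

/-! ### The elliptic normal curve -/

/-- The vector `(1, t, …, t^(k-1), t^(k+1))`. (The condition `i ≠ 0` matters only for `k = 0`.) -/
def gammaVec (k : ℕ) (t : ℂ) : Fin (k + 1) → ℂ :=
  fun i => if i = Fin.last k ∧ i ≠ 0 then t ^ (k + 1) else t ^ (i : ℕ)

theorem gammaVec_ne_zero (k : ℕ) (t : ℂ) : gammaVec k t ≠ 0 := fun h => by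
  have h0 := congrFun h 0
  simp [gammaVec] at h0

/-- The parametrization `γ : P^1 = ℂ ∪ {∞} → P^k` of the elliptic normal curve `C = γ(P^1)`:
`γ(t) = [1 : t : ⋯ : t^(k-1) : t^(k+1)]`, and `γ(∞) = [0 : ⋯ : 0 : 1]` is the cusp. -/
def gamma (k : ℕ) : OnePoint ℂ → ProjSpace k
  | some t => Projectivization.mk ℂ (gammaVec k t) (gammaVec_ne_zero k t)
  | none => basePoint k (Fin.last k)

/-- The affine map `t ↦ δ t + τ` of `ℂ`, extended to `ℂ ∪ {∞}` by `∞ ↦ ∞`. -/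
def affineExt (δ τ : ℂ) : OnePoint ℂ → OnePoint ℂ := OnePoint.map (fun t => δ * t + τ)

/-! ### Basic Cremona maps, as partially defined maps -/

/-- The homogeneous polynomial lift `x ↦ x_0 ⋯ x_k (1/x_0, …, 1/x_k)` of the standard Cremona
involution: its `i`-th entry is `∏_{j ≠ i} x_j`. -/
def cremonaLift (k : ℕ) (x : Fin (k + 1) → ℂ) : Fin (k + 1) → ℂ :=
  fun i => ∏ j ∈ Finset.univ.erase i, x j

/-- The standard Cremona involution `J : P^k ⇢ P^k`. It is undefined exactly at the common zeros
of the (coprime) entries of `cremonaLift`. -/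
def cremonaJ (k : ℕ) : ProjSpace k →. ProjSpace k :=
  fun p => ⟨cremonaLift k p.rep ≠ 0, fun h => Projectivization.mk ℂ (cremonaLift k p.rep) h⟩

/-- The basic Cremona map `F = S ∘ J ∘ T⁻¹`. -/
def basicCremona {k : ℕ} (S T : GL (Fin (k + 1)) ℂ) : ProjSpace k →. ProjSpace k :=
  fun p => (cremonaJ k (T⁻¹ • p)).map (fun q => S • q)

/-- The linear conjugate `A⁻¹ ∘ F ∘ A`. -/
def linConj {k : ℕ} (A : GL (Fin (k + 1)) ℂ) (F : ProjSpace k →. ProjSpace k) :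
    ProjSpace k →. ProjSpace k :=
  fun p => (F (A • p)).map (fun q => A⁻¹ • q)

/-- The indeterminacy set `I(F)`. -/
def indeterminacy {k : ℕ} (F : ProjSpace k →. ProjSpace k) : Set (ProjSpace k) :=
  {p | ¬ (F p).Dom}

/-- The iterates of a partially defined map. -/
def partialIterate {X : Type*} (F : X →. X) : ℕ → (X →. X)
  | 0 => PFun.id X
  | m + 1 => F.comp (partialIterate F m)

/-- The basic Cremona map `F = S ∘ J ∘ T⁻¹` properly fixes the curve `C`, with `F|_C` given by
`γ(t) ↦ γ(δ t + τ)`; the number `δ ≠ 0` is the multiplier of `F|_C`. -/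
structure ProperlyFixes {k : ℕ} (S T : GL (Fin (k + 1)) ℂ) (δ τ : ℂ) : Prop where
  /-- `F` is centered on `C`: all points `T(e_j)` lie on `C_reg = γ(ℂ)`. -/
  centered : ∀ j, ∃ t : ℂ, T • basePoint k j = gamma k (t : OnePoint ℂ)
  multiplier_ne_zero : δ ≠ 0
  restrict : ∀ t : OnePoint ℂ, gamma k t ∉ indeterminacy (basicCremona S T) →
    gamma k (affineExt δ τ t) ∈ basicCremona S T (gamma k t)

/-- The basic Cremona map `F = S ∘ J ∘ T⁻¹` has orbit data `(n_0, …, n_k)`, `σ`: for all `j` one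
has `n_j ≥ 1`, the points `F^i(S(e_j))` with `0 ≤ i < n_j - 1` are not in `I(F)`, and
`F^(n_j - 1)(S(e_j)) = T(e_(σ j))`. -/
def HasOrbitData {k : ℕ} (S T : GL (Fin (k + 1)) ℂ) (n : Fin (k + 1) → ℕ)
    (σ : Equiv.Perm (Fin (k + 1))) : Prop :=
  ∀ j, 1 ≤ n j ∧
    (∀ i < n j - 1, ∃ q ∈ partialIterate (basicCremona S T) i (S • basePoint k j),
      q ∉ indeterminacy (basicCremona S T)) ∧
    T • basePoint k (σ j) ∈ partialIterate (basicCremona S T) (n j - 1) (S • basePoint k j)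

/-- The orbit lengths `(1, …, 1, n)`. -/
def coxeterLengths (k n : ℕ) : Fin (k + 1) → ℕ := fun j => if j = Fin.last k then n else 1

/-! ### The explicit matrix -/

/-- `β_i = (δ^i - 1) / (δ (δ^(k+1) - δ^i))`. -/
def beta (k : ℕ) (δ : ℂ) (i : ℕ) : ℂ := (δ ^ i - 1) / (δ * (δ ^ (k + 1) - δ ^ i))

/-- The matrix with last column `(1, 1 - β_1, …, 1 - β_k)`, entries `β_1, …, β_k` below the
diagonal, and zeros elsewhere. -/
def coxeterMatrix (k : ℕ) (δ : ℂ) : Matrix (Fin (k + 1)) (Fin (k + 1)) ℂ :=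
  Matrix.of fun i j =>
    (if (i : ℕ) = j + 1 then beta k δ i else 0) +
      (if j = Fin.last k then (if i = 0 then 1 else 1 - beta k δ i) else 0)

end

open scoped Matrix
open Polynomial

/-! ### Cremona maps on representative vectors -/

/-! Write `T(e_j) = γ(p_j)` and `s = ∑ p_j`. A monic polynomial of degree `k + 1` without `t^k` term
is a linear form on `C`, so the hyperplane through the `γ(p_j)`, `j ≠ i`, meets `C` again at `p_i -
s`. After rescaling the columns of `T`, `T⁻¹γ(t)` is therefore a vector `x(t)` of explicit products
(`exists_diagGL_normalization`). A companion vector `y(t)` has `x_i y_i` independent of `i`, so it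
represents `J(x(t))`, and `S y(t)` is proportional to `γ(δt + τ)`.

Comparing polynomial coefficients (`smul_yVec_eq`) shows that the factor is constant, sends
`[1:⋯:1]` to the cusp and gives `(k+1)τ = δ(k-1)s`. At `t = p_j - s`, `y` is a multiple of `e_j`, so
`S(e_j) = γ(δ(p_j - s) + τ)`.

The orbits of length 1 now make the `p_j` a shifted geometric progression `B + δ^j A`
(`orbit_parameters`), and closing the long orbit gives (a). Since `S(e_j) = T(e_{j+1})`, the first
`k` columns of `L` are ratios of normalization factors (`xVec_ratio`); fixing `(1,…,1)` forces the
last column. For (c), normalizing at `[1:⋯:1]` leaves only scalar freedom. -/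

theorem gl_smul_vec {m : ℕ} (A : GL (Fin m) ℂ) (v : Fin m → ℂ) : A • v = A.1 *ᵥ v := rfl

theorem gl_smul_smul_comm {m : ℕ} (A : GL (Fin m) ℂ) (a : ℂ) (v : Fin m → ℂ) :
    A • (a • v) = a • (A • v) := by
  simp [gl_smul_vec, Matrix.mulVec_smul]

theorem cremonaLift_smul (k : ℕ) (a : ℂ) (x : Fin (k + 1) → ℂ) :
    cremonaLift k (a • x) = a ^ k • cremonaLift k x := by
  ext i
  simp [cremonaLift, Finset.prod_mul_distrib]

theorem cremonaLift_mul_self (k : ℕ) (x : Fin (k + 1) → ℂ) (i : Fin (k + 1)) :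
    x i * cremonaLift k x i = ∏ j, x j :=
  Finset.mul_prod_erase _ _ (Finset.mem_univ i)

/-- Diagonal rescalings whose product is a scalar intertwine the Cremona lift with itself. -/
theorem mul_cremonaLift_mul (k : ℕ) (c e x : Fin (k + 1) → ℂ) (b : ℂ)
    (hce : ∀ i, e i = b * c i) (i : Fin (k + 1)) :
    e i * cremonaLift k (fun j => c j * x j) i = (b * ∏ j, c j) * cremonaLift k x i := by
  rw [hce i, ← Finset.mul_prod_erase _ _ (Finset.mem_univ i)]
  simp only [cremonaLift, Finset.prod_mul_distrib]
  ring

/-- Homogeneity of degree `k` removes the dependence on the chosen representative `rep`. -/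
theorem mem_cremonaJ_mk {k : ℕ} {v : Fin (k + 1) → ℂ} (hv : v ≠ 0) (q : ProjSpace k) :
    q ∈ cremonaJ k (Projectivization.mk ℂ v hv) ↔
      ∃ h : cremonaLift k v ≠ 0, q = Projectivization.mk ℂ (cremonaLift k v) h := by
  obtain ⟨a, ha⟩ := Projectivization.exists_smul_eq_mk_rep ℂ v hv
  have hrep : cremonaLift k (Projectivization.mk ℂ v hv).rep = (a : ℂ) ^ k • cremonaLift k v := by
    rw [← ha, Units.smul_def, cremonaLift_smul]
  have ha0 : (a : ℂ) ^ k ≠ 0 := pow_ne_zero _ a.ne_zero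
  have key : ∀ (h : cremonaLift k (Projectivization.mk ℂ v hv).rep ≠ 0)
      (h' : cremonaLift k v ≠ 0), Projectivization.mk ℂ _ h = Projectivization.mk ℂ _ h' := by
    intro h h'
    rw [Projectivization.mk_eq_mk_iff']
    exact ⟨_, hrep.symm⟩
  constructor
  · rintro ⟨h, rfl⟩
    have h' : cremonaLift k v ≠ 0 := fun h0 => h (by rw [hrep, h0, smul_zero])
    exact ⟨h', key h h'⟩
  · rintro ⟨h', rfl⟩
    have h : cremonaLift k (Projectivization.mk ℂ v hv).rep ≠ 0 := by
      rw [hrep]; exact smul_ne_zero ha0 h'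
    exact ⟨h, key h h'⟩

/-- The polynomial lift of the basic Cremona map `S ∘ J ∘ T⁻¹`. -/
def basicLift {k : ℕ} (S T : GL (Fin (k + 1)) ℂ) (v : Fin (k + 1) → ℂ) : Fin (k + 1) → ℂ :=
  S • cremonaLift k (T⁻¹ • v)

theorem mem_basicCremona_mk {k : ℕ} (S T : GL (Fin (k + 1)) ℂ) {v : Fin (k + 1) → ℂ}
    (hv : v ≠ 0) (q : ProjSpace k) :
    q ∈ basicCremona S T (Projectivization.mk ℂ v hv) ↔
      ∃ h : basicLift S T v ≠ 0, q = Projectivization.mk ℂ (basicLift S T v) h := by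
  unfold basicCremona
  rw [Part.mem_map_iff, Projectivization.smul_mk]
  simp only [mem_cremonaJ_mk]
  constructor
  · rintro ⟨_, ⟨h, rfl⟩, rfl⟩
    exact ⟨(smul_ne_zero_iff_ne S).2 h, rfl⟩
  · rintro ⟨h, rfl⟩
    exact ⟨_, ⟨(smul_ne_zero_iff_ne S).1 h, rfl⟩, rfl⟩

theorem notMem_indeterminacy_iff {k : ℕ} (F : ProjSpace k →. ProjSpace k) (p : ProjSpace k) :
    p ∉ indeterminacy F ↔ ∃ q, q ∈ F p := by
  simp [indeterminacy, Part.dom_iff_mem]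

theorem basicCremona_eq_of_lift {k : ℕ} (S T S' T' : GL (Fin (k + 1)) ℂ) (a : ℂ) (ha : a ≠ 0)
    (h : ∀ v, basicLift S' T' v = a • basicLift S T v) :
    basicCremona S' T' = basicCremona S T := by
  funext p
  induction p using Projectivization.ind with
  | h v hv =>
    ext q
    rw [mem_basicCremona_mk, mem_basicCremona_mk]
    constructor
    · rintro ⟨h1, rfl⟩
      have h2 : basicLift S T v ≠ 0 := fun h0 => h1 (by rw [h, h0, smul_zero])
      exact ⟨h2, (Projectivization.mk_eq_mk_iff' ..).2 ⟨a, (h v).symm⟩⟩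
    · rintro ⟨h2, rfl⟩
      have h1 : basicLift S' T' v ≠ 0 := by rw [h]; exact smul_ne_zero ha h2
      exact ⟨h1, ((Projectivization.mk_eq_mk_iff' ..).2 ⟨a, (h v).symm⟩).symm⟩

/-- `basicCremona L 1` is how `L ∘ J` is expressed. -/
theorem linConj_basicCremona {k : ℕ} (S T : GL (Fin (k + 1)) ℂ) :
    linConj T (basicCremona S T) = basicCremona (T⁻¹ * S) 1 := by
  funext p
  unfold linConj basicCremona
  rw [inv_smul_smul, inv_one, one_smul, Part.map_map]
  congr 1
  funext q
  simp [mul_smul]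

/-- Invertible diagonal matrices. -/
def diagGL {m : ℕ} (c : Fin m → ℂˣ) : GL (Fin m) ℂ where
  val := Matrix.diagonal fun i => (c i : ℂ)
  inv := Matrix.diagonal fun i => ((c i)⁻¹ : ℂˣ)
  val_inv := by simp [Matrix.diagonal_mul_diagonal]
  inv_val := by simp [Matrix.diagonal_mul_diagonal]

theorem diagGL_smul_apply {m : ℕ} (c : Fin m → ℂˣ) (v : Fin m → ℂ) (i : Fin m) :
    (diagGL c • v) i = c i * v i := by
  simp [diagGL, Matrix.mulVec_diagonal]

theorem diagGL_inv_smul_apply {m : ℕ} (c : Fin m → ℂˣ) (v : Fin m → ℂ) (i : Fin m) :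
    ((diagGL c)⁻¹ • v) i = (c i : ℂ)⁻¹ * v i := by
  have : (diagGL c)⁻¹.1 = Matrix.diagonal fun i => (((c i)⁻¹ : ℂˣ) : ℂ) := rfl
  simp [gl_smul_vec, this, Matrix.mulVec_diagonal]

theorem diagGL_smul_single {m : ℕ} (c : Fin m → ℂˣ) (j : Fin m) :
    diagGL c • (Pi.single j 1 : Fin m → ℂ) = (c j : ℂ) • Pi.single j 1 := by
  ext i
  rw [diagGL_smul_apply]
  by_cases h : i = j
  · subst h; simp
  · simp [h]

theorem smul_diagGL_smul_basePoint {k : ℕ} (A : GL (Fin (k + 1)) ℂ) (c : Fin (k + 1) → ℂˣ)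
    (j : Fin (k + 1)) : (A * diagGL c) • basePoint k j = A • basePoint k j := by
  simp only [basePoint, Projectivization.smul_mk]
  rw [Projectivization.mk_eq_mk_iff']
  exact ⟨c j, by rw [mul_smul, diagGL_smul_single, gl_smul_smul_comm]⟩

/-- Rescaling the columns of `S` and `T` oppositely does not change `S ∘ J ∘ T⁻¹`. -/
theorem basicCremona_mul_diagGL {k : ℕ} (S T : GL (Fin (k + 1)) ℂ) (c e : Fin (k + 1) → ℂˣ)
    (b : ℂˣ) (h : ∀ i, e i * c i = b) :
    basicCremona (S * diagGL e) (T * diagGL c) = basicCremona S T := by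
  refine basicCremona_eq_of_lift _ _ _ _ ((b : ℂ) * ∏ j, (c j : ℂ)⁻¹) ?_ fun v => ?_
  · exact mul_ne_zero b.ne_zero (Finset.prod_ne_zero_iff.2 fun j _ => inv_ne_zero (c j).ne_zero)
  · unfold basicLift
    rw [mul_inv_rev, mul_smul, mul_smul, ← gl_smul_smul_comm]
    congr 1
    ext i
    rw [diagGL_smul_apply, Pi.smul_apply, smul_eq_mul, ← mul_cremonaLift_mul k
      (fun j => (c j : ℂ)⁻¹) (fun j => e j) (T⁻¹ • v) b]
    · congr 2
      ext j
      rw [diagGL_inv_smul_apply]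
    · intro i
      rw [← h i]
      simp

/-! ### Monic polynomials with prescribed roots and the curve -/

/-- The monic polynomial with roots `r_0, …, r_k`. -/
noncomputable def rootPoly {k : ℕ} (r : Fin (k + 1) → ℂ) : ℂ[X] := ∏ j, (X - C (r j))

theorem rootPoly_natDegree {k : ℕ} (r : Fin (k + 1) → ℂ) : (rootPoly r).natDegree = k + 1 := by
  simp [rootPoly, natDegree_finsetProd_X_sub_C_eq_card]

theorem rootPoly_monic {k : ℕ} (r : Fin (k + 1) → ℂ) : (rootPoly r).Monic :=
  monic_prod_X_sub_C _ _

theorem rootPoly_coeff_succ {k : ℕ} (r : Fin (k + 1) → ℂ) : (rootPoly r).coeff (k + 1) = 1 := by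
  have := rootPoly_monic r
  rwa [Monic, leadingCoeff, rootPoly_natDegree] at this

theorem rootPoly_coeff {k : ℕ} (r : Fin (k + 1) → ℂ) : (rootPoly r).coeff k = -∑ j, r j := by
  have := prod_X_sub_C_coeff_card_pred Finset.univ r (by simp)
  simpa [rootPoly] using this

theorem rootPoly_eval {k : ℕ} (r : Fin (k + 1) → ℂ) (t : ℂ) :
    (rootPoly r).eval t = ∏ j, (t - r j) := by
  simp [rootPoly, eval_prod]

theorem gammaVec_castSucc {k : ℕ} (t : ℂ) (i : Fin k) : gammaVec k t i.castSucc = t ^ (i : ℕ) := by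
  simp [gammaVec, (Fin.castSucc_lt_last i).ne]

theorem gammaVec_last {k : ℕ} (hk : 2 ≤ k) (t : ℂ) : gammaVec k t (Fin.last k) = t ^ (k + 1) := by
  have : Fin.last k ≠ 0 := by
    intro h
    have := congrArg Fin.val h
    simp at this
    omega
  simp [gammaVec, this]

theorem gammaVec_zero (k : ℕ) (t : ℂ) : gammaVec k t 0 = 1 := by
  simp [gammaVec]

theorem gammaVec_one {k : ℕ} (hk : 2 ≤ k) (t : ℂ) :
    gammaVec k t (⟨1, by omega⟩ : Fin k).castSucc = t := by
  rw [gammaVec_castSucc, pow_one]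

theorem gamma_coe_injective {k : ℕ} (hk : 2 ≤ k) {s t : ℂ}
    (h : gamma k (s : OnePoint ℂ) = gamma k (t : OnePoint ℂ)) : s = t := by
  obtain ⟨a, ha⟩ := (Projectivization.mk_eq_mk_iff' ..).1 h
  have h0 := congrFun ha 0
  have h1 := congrFun ha (⟨1, by omega⟩ : Fin k).castSucc
  rw [Pi.smul_apply, gammaVec_zero, gammaVec_zero, smul_eq_mul, mul_one] at h0
  rw [Pi.smul_apply, gammaVec_one hk, gammaVec_one hk, h0, smul_eq_mul, one_mul] at h1
  exact h1.symm

/-- The coefficients of a monic polynomial of degree `k + 1` at the exponents of `gammaVec`. -/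
noncomputable def rootRow {k : ℕ} (r : Fin (k + 1) → ℂ) : Fin (k + 1) → ℂ :=
  Fin.snoc (α := fun _ => ℂ) (fun i : Fin k => (rootPoly r).coeff i) 1

theorem rootRow_last {k : ℕ} (r : Fin (k + 1) → ℂ) : rootRow r (Fin.last k) = 1 := by
  simp [rootRow]

/-- A degree `k + 1` divisor of `ℂ` with sum zero is a hyperplane section of the curve. -/
theorem rootRow_dotProduct_gammaVec {k : ℕ} (hk : 2 ≤ k) (r : Fin (k + 1) → ℂ)
    (hr : ∑ j, r j = 0) (t : ℂ) : rootRow r ⬝ᵥ gammaVec k t = ∏ j, (t - r j) := by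
  -- The exponent `k` skipped by `gammaVec` costs nothing: the coefficient of `t^k` is `-∑ r_j = 0`.
  rw [← rootPoly_eval, eval_eq_sum_range' (n := k + 2) (by rw [rootPoly_natDegree]; omega),
    Finset.sum_range_succ, Finset.sum_range_succ, rootPoly_coeff_succ, rootPoly_coeff, hr,
    Finset.sum_range, dotProduct, Fin.sum_univ_castSucc]
  simp [rootRow, gammaVec_castSucc, gammaVec_last hk]

/-- The parameters other than `p_i` on the hyperplane through `γ(p_j)`, `j ≠ i`; the
`i`-th entry is the residual point. -/
def xRoot {k : ℕ} (p : Fin (k + 1) → ℂ) (i j : Fin (k + 1)) : ℂ :=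
  if j = i then p i - ∑ l, p l else p j

/-- The roots of the `i`-th entry of the Cremona image of the curve. -/
def yRoot {k : ℕ} (p : Fin (k + 1) → ℂ) (i j : Fin (k + 1)) : ℂ :=
  if j = i then p i else p j - ∑ l, p l

/-- The curve in the coordinates given by the hyperplanes spanned by the `γ(p_j)`. -/
def xVec {k : ℕ} (p : Fin (k + 1) → ℂ) (t : ℂ) : Fin (k + 1) → ℂ := fun i => ∏ j, (t - xRoot p i j)

/-- The Cremona image of `xVec`, without common factors. -/
def yVec {k : ℕ} (p : Fin (k + 1) → ℂ) (t : ℂ) : Fin (k + 1) → ℂ := fun i => ∏ j, (t - yRoot p i j)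

theorem sum_xRoot {k : ℕ} (p : Fin (k + 1) → ℂ) (i : Fin (k + 1)) : ∑ j, xRoot p i j = 0 := by
  have : ∀ j, xRoot p i j = p j - if j = i then ∑ l, p l else 0 := by
    intro j
    by_cases h : j = i
    · subst h; simp [xRoot]
    · simp [xRoot, h]
  simp [this]

theorem sum_yRoot {k : ℕ} (p : Fin (k + 1) → ℂ) (i : Fin (k + 1)) :
    ∑ j, yRoot p i j = (1 - k) * ∑ l, p l := by
  have : ∀ j, yRoot p i j = p j - (∑ l, p l) + if j = i then ∑ l, p l else 0 := by
    intro j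
    by_cases h : j = i
    · subst h; simp [yRoot]
    · simp [yRoot, h]
  simp only [this, Finset.sum_add_distrib, Finset.sum_sub_distrib]
  simp
  ring

theorem xVec_mul_yVec {k : ℕ} (p : Fin (k + 1) → ℂ) (t : ℂ) (i : Fin (k + 1)) :
    xVec p t i * yVec p t i = ∏ j, ((t - p j) * (t - (p j - ∑ l, p l))) := by
  rw [xVec, yVec, ← Finset.prod_mul_distrib]
  refine Finset.prod_congr rfl fun j _ => ?_
  by_cases h : j = i
  · subst h; simp [xRoot, yRoot, mul_comm]
  · simp [xRoot, yRoot, h]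

theorem xVec_self_of_ne {k : ℕ} (p : Fin (k + 1) → ℂ) {i j : Fin (k + 1)} (h : i ≠ j) :
    xVec p (p j) i = 0 :=
  Finset.prod_eq_zero (Finset.mem_univ j) (by simp [xRoot, h.symm])

theorem yVec_self_of_ne {k : ℕ} (p : Fin (k + 1) → ℂ) {i j : Fin (k + 1)} (h : i ≠ j) :
    yVec p (p j - ∑ l, p l) i = 0 :=
  Finset.prod_eq_zero (Finset.mem_univ j) (by simp [yRoot, h.symm])

theorem xVec_self {k : ℕ} (p : Fin (k + 1) → ℂ) (i : Fin (k + 1)) :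
    xVec p (p i) i = ∏ j, if j = i then ∑ l, p l else p i - p j := by
  refine Finset.prod_congr rfl fun j _ => ?_
  by_cases h : j = i
  · subst h; simp [xRoot]
  · simp [xRoot, h]

/-- At `t = p_i - s` the factor `t - p_i` is `-s` and the others are `p_i - p_j`; only the sign of
`s` differs from `xVec_self`. -/
theorem yVec_self {k : ℕ} (p : Fin (k + 1) → ℂ) (i : Fin (k + 1)) :
    yVec p (p i - ∑ l, p l) i = -xVec p (p i) i := by
  rw [xVec_self, yVec, ← Finset.mul_prod_erase _ _ (Finset.mem_univ i),
    ← Finset.mul_prod_erase _ _ (Finset.mem_univ i), ← neg_mul]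
  congr 1
  · simp [yRoot]
  · refine Finset.prod_congr rfl fun j hj => ?_
    simp [yRoot, Finset.ne_of_mem_erase hj]

theorem xVec_self_eq_smul {k : ℕ} (p : Fin (k + 1) → ℂ) (j : Fin (k + 1)) :
    xVec p (p j) = xVec p (p j) j • Pi.single j 1 := by
  ext i
  by_cases h : i = j
  · subst h; simp
  · simp [h, xVec_self_of_ne p h]

theorem yVec_self_eq_smul {k : ℕ} (p : Fin (k + 1) → ℂ) (j : Fin (k + 1)) :
    yVec p (p j - ∑ l, p l) = -xVec p (p j) j • Pi.single j 1 := by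
  ext i
  by_cases h : i = j
  · subst h; simp [yVec_self]
  · simp [h, yVec_self_of_ne p h]

/-- If the `T(e_j)` are on the curve, the columns of `T` can be rescaled such that `T⁻¹` is given
by the hyperplanes spanned by the `T(e_j)`. -/
theorem exists_diagGL_normalization {k : ℕ} (hk : 2 ≤ k) (T : GL (Fin (k + 1)) ℂ)
    (p : Fin (k + 1) → ℂ) (hp : ∀ j, T • basePoint k j = gamma k (p j : OnePoint ℂ)) :
    ∃ c : Fin (k + 1) → ℂˣ, (∀ j, xVec p (p j) j ≠ 0) ∧
      (∀ t, (T * diagGL c)⁻¹ • gammaVec k t = xVec p t) ∧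
      (T * diagGL c) • (fun _ => 1) = (Pi.single (Fin.last k) 1 : Fin (k + 1) → ℂ) := by
  have hcol : ∀ j, ∃ a : ℂ, T • (Pi.single j 1 : Fin (k + 1) → ℂ) = a • gammaVec k (p j) := by
    intro j
    obtain ⟨a, ha⟩ := (Projectivization.mk_eq_mk_iff' ..).1 (hp j)
    exact ⟨a, ha.symm⟩
  choose a ha using hcol
  let W : Matrix (Fin (k + 1)) (Fin (k + 1)) ℂ := Matrix.of fun i => rootRow (xRoot p i)
  have hW : ∀ t, W *ᵥ gammaVec k t = xVec p t := fun t => by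
    ext i
    exact rootRow_dotProduct_gammaVec hk _ (sum_xRoot p i) t
  have hWT : W * T.1 = Matrix.diagonal fun j => a j * xVec p (p j) j := by
    ext i j
    have h1 : (W * T.1) i j = (W *ᵥ (T • (Pi.single j 1 : Fin (k + 1) → ℂ))) i := by
      rw [gl_smul_vec, Matrix.mulVec_mulVec, Matrix.mulVec_single_one]
      rfl
    rw [h1, ha, Matrix.mulVec_smul, hW, Pi.smul_apply, smul_eq_mul]
    by_cases h : i = j
    · subst h; simp
    · rw [xVec_self_of_ne p h, Matrix.diagonal_apply_ne _ h, mul_zero]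
  -- A zero diagonal entry would make row `j` of `W` vanish, but each row of `W` ends in the leading
  -- coefficient 1.
  have hd : ∀ j, a j * xVec p (p j) j ≠ 0 := by
    intro j h0
    have h1 : W = (Matrix.diagonal fun j => a j * xVec p (p j) j) * T⁻¹.1 := by
      rw [← hWT, Matrix.mul_assoc, ← Units.val_mul, mul_inv_cancel, Units.val_one, Matrix.mul_one]
    have h2 := congrFun (congrFun h1 j) (Fin.last k)
    rw [Matrix.diagonal_mul, h0, zero_mul] at h2
    exact one_ne_zero ((rootRow_last _).symm.trans h2)
  let c : Fin (k + 1) → ℂˣ := fun j => (Units.mk0 _ (hd j))⁻¹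
  have hinv : (T * diagGL c)⁻¹.1 = W := by
    have h1 : W * (T * diagGL c).1 = 1 := by
      rw [Units.val_mul, ← Matrix.mul_assoc, hWT]
      simp only [diagGL, Matrix.diagonal_mul_diagonal, c]
      rw [← Matrix.diagonal_one]
      congr 1
      ext j
      simp only [Units.val_inv_eq_inv_val, Units.val_mk0]
      exact mul_inv_cancel₀ (hd j)
    exact (Units.eq_inv_of_mul_eq_one_right (u := T * diagGL c) h1).symm
  refine ⟨c, fun j h0 => hd j (by rw [h0, mul_zero]), fun t => ?_, ?_⟩
  · rw [gl_smul_vec, hinv, hW]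
  -- The last column of `W` consists of leading coefficients, all equal to 1.
  · rw [← eq_inv_smul_iff, gl_smul_vec, hinv, Matrix.mulVec_single_one]
    ext i
    exact (rootRow_last _).symm

/-! ### The restriction of the Cremona map to the curve -/

theorem coeff_linear_pow (δ τ : ℂ) (hδ : δ ≠ 0) (m : ℕ) :
    ((C δ * X + C τ) ^ (m + 1)).natDegree = m + 1 ∧
    ((C δ * X + C τ) ^ (m + 1)).coeff (m + 1) = δ ^ (m + 1) ∧
    ((C δ * X + C τ) ^ (m + 1)).coeff m = (m + 1) * δ ^ m * τ := by
  have h : (C δ * X + C τ) ^ (m + 1) = C (δ ^ (m + 1)) * (X + C (τ / δ)) ^ (m + 1) := by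
    rw [C_pow, ← mul_pow, mul_add, ← C_mul, mul_div_cancel₀ _ hδ]
  refine ⟨?_, ?_, ?_⟩
  · rw [natDegree_pow, natDegree_linear hδ, mul_one]
  · rw [h, coeff_C_mul, coeff_X_add_C_pow]; simp
  · rw [h, coeff_C_mul, coeff_X_add_C_pow]
    simp
    field_simp
    ring

theorem xVec_eq_eval {k : ℕ} (p : Fin (k + 1) → ℂ) (t : ℂ) (i : Fin (k + 1)) :
    xVec p t i = (rootPoly (xRoot p i)).eval t := (rootPoly_eval _ _).symm

/-- If an invertible matrix maps `yVec p t` to the line of `γ(δ t + τ)` for generic `t`, then it does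
so for all `t`, with a constant factor; this determines the translation `τ`. -/
theorem smul_yVec_eq {k : ℕ} (hk : 2 ≤ k) (S : GL (Fin (k + 1)) ℂ) (p : Fin (k + 1) → ℂ) (δ τ : ℂ)
    (hδ : δ ≠ 0)
    (h : ∀ t, (∀ i, xVec p t i ≠ 0) → ∃ a : ℂ, S • yVec p t = a • gammaVec k (δ * t + τ)) :
    ∃ a : ℂ, a ≠ 0 ∧ (∀ t, S • yVec p t = a • gammaVec k (δ * t + τ)) ∧
      S • (fun _ => 1) = (a * δ ^ (k + 1)) • (Pi.single (Fin.last k) 1 : Fin (k + 1) → ℂ) ∧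
      (k + 1) * τ = δ * (k - 1) * ∑ j, p j := by
  let Q : Fin (k + 1) → ℂ[X] := fun i => ∑ j, C (S.1 i j) * rootPoly (yRoot p j)
  let e : Fin (k + 1) → ℕ := Fin.snoc (α := fun _ => ℕ) (fun i : Fin k => (i : ℕ)) (k + 1)
  have hQ : ∀ i t, (Q i).eval t = (S • yVec p t) i := by
    intro i t
    simp only [Q, eval_finsetSum, eval_mul, eval_C, rootPoly_eval]
    rfl
  have he : ∀ i t, gammaVec k t i = t ^ e i := by
    intro i t
    induction i using Fin.lastCases with
    | last => rw [gammaVec_last hk]; simp [e]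
    | cast i => rw [gammaVec_castSucc]; simp [e]
  have hM : ∏ i, rootPoly (xRoot p i) ≠ 0 :=
    Finset.prod_ne_zero_iff.2 fun i _ => (rootPoly_monic _).ne_zero
  have hQe : ∀ i, Q i = Q 0 * (C δ * X + C τ) ^ e i := by
    intro i
    -- Multiplying by the polynomials of the `x_i` kills the parameters not covered by `h`, so the
    -- identity holds at every `t`; the nonzero factor is then cancelled.
    have h0 : (Q i - Q 0 * (C δ * X + C τ) ^ e i) * ∏ i, rootPoly (xRoot p i) = 0 := by
      refine Polynomial.funext fun t => ?_
      by_cases ht : ∀ i, xVec p t i ≠ 0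
      · obtain ⟨a, ha⟩ := h t ht
        simp [hQ, ha, he]
        left
        have : e 0 = 0 := by
          have : (0 : Fin (k + 1)) = (⟨0, by omega⟩ : Fin k).castSucc := rfl
          rw [this]
          simp only [e, Fin.snoc_castSucc]
        simp [this]
      · push Not at ht
        obtain ⟨j, hj⟩ := ht
        rw [xVec_eq_eval] at hj
        rw [eval_mul, eval_prod, Finset.prod_eq_zero (Finset.mem_univ j) hj]
        simp
    rcases mul_eq_zero.1 h0 with h1 | h1
    · exact sub_eq_zero.1 h1
    · exact absurd h1 hM
  have hdeg : ∀ i, (Q i).natDegree ≤ k + 1 := by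
    intro i
    refine natDegree_sum_le_of_forall_le _ _ fun j _ => ?_
    exact (natDegree_C_mul_le _ _).trans (rootPoly_natDegree _).le
  have htop : ∀ i, (Q i).coeff (k + 1) = (S • (fun _ => (1 : ℂ))) i := by
    intro i
    simp only [Q, finsetSum_coeff, coeff_C_mul, rootPoly_coeff_succ]
    rfl
  have hnext : ∀ i, (Q i).coeff k =
      (S • (fun _ => (1 : ℂ))) i * ((k - 1) * ∑ j, p j) := by
    intro i
    simp only [Q, finsetSum_coeff, coeff_C_mul, rootPoly_coeff, sum_yRoot]
    rw [← Finset.sum_mul, gl_smul_vec]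
    simp only [Matrix.mulVec, dotProduct, mul_one]
    ring
  have hQ0 : Q 0 ≠ 0 := by
    intro h0
    have h1 : S • (fun _ : Fin (k + 1) => (1 : ℂ)) = 0 := by
      ext i
      rw [← htop, hQe, h0]
      simp
    rw [smul_eq_zero_iff_eq] at h1
    exact one_ne_zero (congrFun h1 0)
  have helast : e (Fin.last k) = k + 1 := by simp [e]
  have hecast : ∀ i : Fin k, e i.castSucc = i := fun i => by simp [e]
  obtain ⟨hd1, hd2, hd3⟩ := coeff_linear_pow δ τ hδ k
  have hQlast := hQe (Fin.last k)
  rw [helast] at hQlast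
  -- The last entry already uses up the whole degree `k + 1`, leaving `Q 0` constant.
  have hdeg0 : (Q 0).natDegree = 0 := by
    have h1 := hdeg (Fin.last k)
    have h2 : ((C δ * X + C τ) ^ (k + 1)) ≠ 0 := by
      intro h3
      rw [h3] at hd1
      simp at hd1
    rw [hQlast, natDegree_mul hQ0 h2, hd1] at h1
    omega
  obtain ⟨a, ha⟩ := natDegree_eq_zero.1 hdeg0
  have ha0 : a ≠ 0 := by
    rintro rfl
    exact hQ0 (by rw [← ha, C_0])
  rw [← ha] at hQlast
  have hSlast : (S • (fun _ : Fin (k + 1) => (1 : ℂ))) (Fin.last k) = a * δ ^ (k + 1) := by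
    rw [← htop, hQlast, coeff_C_mul, hd2]
  refine ⟨a, ha0, fun t => ?_, ?_, ?_⟩
  · ext i
    rw [← hQ, hQe, ← ha, Pi.smul_apply, he]
    simp
  · ext i
    induction i using Fin.lastCases with
    | last => rw [hSlast]; simp
    | cast i =>
      rw [← htop, hQe, hecast, ← ha, coeff_C_mul, coeff_eq_zero_of_natDegree_lt]
      · simp [(Fin.castSucc_lt_last i).ne]
      · rw [natDegree_pow, natDegree_linear hδ]
        have := i.2
        omega
  -- The `t^k` coefficients in the last row determine `τ`.
  · have h1 := hnext (Fin.last k)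
    rw [hSlast, hQlast, coeff_C_mul, hd3] at h1
    have h2 : a * δ ^ k * ((k + 1) * τ) = a * δ ^ k * (δ * (k - 1) * ∑ j, p j) := by
      rw [pow_succ] at h1
      linear_combination h1
    exact mul_left_cancel₀ (mul_ne_zero ha0 (pow_ne_zero _ hδ)) h2

/-! ### The parameters of the base points -/

/-- The parameters of an orbit segment of `t ↦ δ t + τ - δ s` whose sum is `s`. -/
theorem orbit_parameters {k : ℕ} (δ τ s : ℂ) (hδ : δ ≠ 1) (hδk : δ ^ (k + 1) ≠ 1)
    (p : Fin (k + 1) → ℂ) (hs : ∑ j, p j = s) (hτ : (k + 1) * τ = δ * (k - 1) * s)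
    (hrec : ∀ i : Fin k, p i.succ = δ * (p i.castSucc - s) + τ) :
    ∃ A B : ℂ, A * (δ ^ (k + 1) - 1) = -s * (δ + 1) ∧ B * (δ - 1) = δ * s - τ ∧
      ∀ i, p i = B + δ ^ (i : ℕ) * A := by
  have h1 : δ - 1 ≠ 0 := sub_ne_zero.2 hδ
  have h2 : δ ^ (k + 1) - 1 ≠ 0 := sub_ne_zero.2 hδk
  -- `B` is the fixed point of `t ↦ δ(t - s) + τ`.
  obtain ⟨B, hB⟩ : ∃ B : ℂ, B * (δ - 1) = δ * s - τ := ⟨(δ * s - τ) / (δ - 1), by field_simp⟩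
  have hp : ∀ i : Fin (k + 1), p i = B + δ ^ (i : ℕ) * (p 0 - B) := by
    intro i
    induction i using Fin.induction with
    | zero => simp
    | succ i ih =>
      rw [hrec, ih, Fin.val_succ, Fin.val_castSucc, pow_succ]
      linear_combination hB
  refine ⟨p 0 - B, B, ?_, hB, hp⟩
  have hsum : (k + 1) * B + (∑ i ∈ Finset.range (k + 1), δ ^ i) * (p 0 - B) = s := by
    rw [← hs, Finset.sum_congr rfl fun i _ => hp i, Finset.sum_add_distrib, Finset.sum_range,
      Finset.sum_mul]
    simp
  have hgeom := geom_sum_mul δ (k + 1)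
  linear_combination (δ - 1) * hsum - (p 0 - B) * hgeom - (k + 1) * hB + hτ

/-- Shifting `j` by one matches the two products up to powers of `δ`; only the end factors `j = 0`
and `j = k + 1` remain. In `hshift` an extra `δ` also scales the entry `s`. -/
theorem prod_ite_pow_sub_pow (k i : ℕ) (hi : i < k) (δ A s : ℂ) (hδ : δ ≠ 0) (hA : A ≠ 0) :
    (∏ j ∈ Finset.range (k + 1), if j = i + 1 then s else A * (δ ^ (i + 1) - δ ^ j)) *
        (δ ^ (i + 1) - δ ^ (k + 1)) =
      (δ ^ (i + 1) - 1) * δ ^ k *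
        ∏ j ∈ Finset.range (k + 1), if j = i then s else A * (δ ^ i - δ ^ j) := by
  have hshift : δ * (∏ j ∈ Finset.range (k + 1),
      if j = i then s else A * (δ ^ (i + 1) - δ ^ (j + 1))) =
      δ ^ (k + 1) * ∏ j ∈ Finset.range (k + 1), if j = i then s else A * (δ ^ i - δ ^ j) := by
    have h1 : (∏ j ∈ Finset.range (k + 1), if j = i then δ else 1) = δ := by
      simp [Finset.prod_ite_eq', show i < k + 1 by omega]
    have h2 : δ ^ (k + 1) = ∏ j ∈ Finset.range (k + 1), δ := by simp
    rw [h2, ← Finset.prod_mul_distrib]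
    nth_rewrite 1 [← h1]
    rw [← Finset.prod_mul_distrib]
    refine Finset.prod_congr rfl fun j _ => ?_
    split_ifs
    · rfl
    · ring
  have h3 := Finset.prod_range_succ
    (fun j => if j = i + 1 then s else A * (δ ^ (i + 1) - δ ^ j)) (k + 1)
  rw [Finset.prod_range_succ'] at h3
  simp only [add_left_inj, show k + 1 ≠ i + 1 by omega, if_false,
    show (0 : ℕ) ≠ i + 1 by omega, pow_zero] at h3
  refine mul_left_cancel₀ (mul_ne_zero hδ hA) ?_
  linear_combination -δ * h3 + A * (δ ^ (i + 1) - 1) * hshift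

/-- The ratio of consecutive normalization factors is an entry of the matrix `L`. -/
theorem xVec_ratio {k : ℕ} (p : Fin (k + 1) → ℂ) (δ A B : ℂ) (hδ : δ ≠ 0) (hA : A ≠ 0)
    (hp : ∀ i, p i = B + δ ^ (i : ℕ) * A) (i : Fin k) (hi : δ ^ (k + 1) ≠ δ ^ ((i : ℕ) + 1)) :
    -xVec p (p i.succ) i.succ =
      beta k δ (i + 1) * δ ^ (k + 1) * xVec p (p i.castSucc) i.castSucc := by
  have hx : ∀ i : Fin (k + 1), xVec p (p i) i = ∏ j ∈ Finset.range (k + 1),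
      if j = (i : ℕ) then ∑ l, p l else A * (δ ^ (i : ℕ) - δ ^ j) := by
    intro i
    rw [xVec_self, Finset.prod_range]
    refine Finset.prod_congr rfl fun j _ => ?_
    simp only [Fin.ext_iff]
    split_ifs
    · rfl
    · rw [hp i, hp j]; ring
  have h := prod_ite_pow_sub_pow k i i.2 δ A (∑ l, p l) hδ hA
  rw [hx, hx, Fin.val_succ, Fin.val_castSucc]
  have h1 : δ ^ (k + 1) - δ ^ ((i : ℕ) + 1) ≠ 0 := sub_ne_zero.2 hi
  unfold beta
  rw [div_mul_eq_mul_div, div_mul_eq_mul_div, eq_div_iff (mul_ne_zero hδ h1), pow_succ δ k]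
  rw [pow_succ δ k] at h
  linear_combination δ * h

/-- The relation between multiplier and orbit length. -/
theorem multiplier_relation {k n : ℕ} (δ τ s A B p0 q : ℂ) (hs : s ≠ 0)
    (hA : A * (δ ^ (k + 1) - 1) = -s * (δ + 1)) (hB : B * (δ - 1) = δ * s - τ)
    (hp0 : p0 = B + A) (hq : q = B + δ ^ (k + 1) * A)
    (horb : (fun t => δ * t + τ)^[n] q = p0) :
    (δ ^ (n + 1 + k) - 1) * (δ ^ 2 - 1) - δ * (δ ^ (k + 1) - 1) * (δ ^ n - 1) = 0 := by
  -- The coordinate `t(δ - 1) + τ` turns `t ↦ δt + τ` into multiplication by `δ`.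
  have hiter : ∀ m, ((fun t => δ * t + τ)^[m] q) * (δ - 1) = δ ^ m * (q * (δ - 1) + τ) - τ := by
    intro m
    induction m with
    | zero => simp
    | succ m ih =>
      rw [Function.iterate_succ_apply', pow_succ]
      linear_combination δ * ih
  have h1 := hiter n
  rw [horb, hp0, hq] at h1
  refine mul_left_cancel₀ hs ?_
  have hpow : δ ^ (n + 1 + k) = δ ^ n * δ ^ (k + 1) := by rw [← pow_add]; congr 1; omega
  rw [hpow, mul_zero]
  linear_combination (δ ^ (k + 1) - 1) * h1 -
    (δ ^ (k + 1) - 1) * (1 - δ ^ n) * hB -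
    (1 - δ ^ n * δ ^ (k + 1)) * (δ - 1) * hA

/-! ### Orbits on the curve and the main theorem -/

/-- Wherever the next iterate is defined the point is off `I(F)`, so `restrict` applies and keeps
the orbit on the curve. -/
theorem mem_partialIterate_gamma {k : ℕ} {S T : GL (Fin (k + 1)) ℂ} {δ τ : ℂ}
    (hfix : ProperlyFixes S T δ τ) (m : ℕ) (t : ℂ) (q : ProjSpace k)
    (hq : q ∈ partialIterate (basicCremona S T) m (gamma k (t : OnePoint ℂ))) :
    q = gamma k (((fun t => δ * t + τ)^[m] t : ℂ) : OnePoint ℂ) := by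
  induction m generalizing q with
  | zero => exact Part.mem_some_iff.1 hq
  | succ m ih =>
    obtain ⟨q', hq', hq⟩ := Part.mem_bind_iff.1 hq
    rw [ih q' hq'] at hq
    rw [Function.iterate_succ_apply']
    exact Part.mem_unique hq
      (hfix.restrict _ ((notMem_indeterminacy_iff _ _).2 ⟨q, hq⟩))

theorem diagGL_mul_left {m : ℕ} (b : ℂˣ) (c : Fin m → ℂˣ) (v : Fin m → ℂ) :
    diagGL (fun i => b * c i) • v = (b : ℂ) • (diagGL c • v) := by
  ext i
  simp [diagGL_smul_apply, mul_assoc]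

/-- Both `x_i y_i` and `x_i J(x)_i` are independent of `i`; `b` is their quotient. It is nonzero
because each root of the numerator is a root of some `x_i`. -/
theorem cremonaLift_xVec {k : ℕ} (hk : 2 ≤ k) (p : Fin (k + 1) → ℂ) (t : ℂ) (h : ∀ i, xVec p t i ≠ 0) :
    ∃ b : ℂ, b ≠ 0 ∧ b • cremonaLift k (xVec p t) = yVec p t := by
  have hprod : ∏ j, xVec p t j ≠ 0 := Finset.prod_ne_zero_iff.2 fun j _ => h j
  by_cases hM : ∏ j, ((t - p j) * (t - (p j - ∑ l, p l))) = 0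
  · exfalso
    obtain ⟨j, -, hj⟩ := Finset.prod_eq_zero_iff.1 hM
    rcases mul_eq_zero.1 hj with h1 | h1
    · have : Nontrivial (Fin (k + 1)) := Fin.nontrivial_iff_two_le.2 (by omega)
      obtain ⟨i, hi⟩ := exists_ne j
      exact h i (by rw [sub_eq_zero.1 h1, xVec_self_of_ne p hi])
    · exact h j (Finset.prod_eq_zero (Finset.mem_univ j) (by simpa [xRoot] using h1))
  · refine ⟨_, div_ne_zero hM hprod, ?_⟩
    ext i
    refine mul_left_cancel₀ (h i) ?_
    rw [xVec_mul_yVec, Pi.smul_apply, smul_eq_mul, mul_left_comm, cremonaLift_mul_self,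
      div_mul_cancel₀ _ hprod]

/-- The Cremona map with normalized `T` maps the curve to the curve, with explicit lifts. -/
theorem smul_yVec_of_restrict {k : ℕ} (hk : 2 ≤ k) (S T : GL (Fin (k + 1)) ℂ)
    (p : Fin (k + 1) → ℂ) (δ τ : ℂ) (hT : ∀ t, T⁻¹ • gammaVec k t = xVec p t)
    (hF : ∀ t : OnePoint ℂ, gamma k t ∉ indeterminacy (basicCremona S T) →
      gamma k (affineExt δ τ t) ∈ basicCremona S T (gamma k t))
    (t : ℂ) (ht : ∀ i, xVec p t i ≠ 0) :
    ∃ a : ℂ, S • yVec p t = a • gammaVec k (δ * t + τ) := by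
  obtain ⟨b, hb, hby⟩ := cremonaLift_xVec hk p t ht
  have hlift : b • basicLift S T (gammaVec k t) = S • yVec p t := by
    rw [basicLift, hT, ← hby, gl_smul_smul_comm]
  have hne : basicLift S T (gammaVec k t) ≠ 0 := by
    rw [basicLift, hT]
    refine (smul_ne_zero_iff_ne S).2 fun h0 => ?_
    have h1 := cremonaLift_mul_self k (xVec p t) 0
    rw [h0, Pi.zero_apply, mul_zero] at h1
    exact Finset.prod_ne_zero_iff.2 (fun j _ => ht j) h1.symm
  have hmem : Projectivization.mk ℂ _ hne ∈ basicCremona S T (gamma k (t : OnePoint ℂ)) :=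
    (mem_basicCremona_mk S T (gammaVec_ne_zero k t) _).2 ⟨hne, rfl⟩
  have h2 := Part.mem_unique hmem (hF t ((notMem_indeterminacy_iff _ _).2 ⟨_, hmem⟩))
  obtain ⟨a, ha⟩ := (Projectivization.mk_eq_mk_iff' ..).1 h2
  exact ⟨b * a, by rw [← hlift, ← ha, smul_smul]⟩

/-- The matrix `L` is determined by its first `k` columns and by fixing `(1, …, 1)`. -/
theorem eq_coxeterMatrix {k : ℕ} (δ : ℂ) (M : Matrix (Fin (k + 1)) (Fin (k + 1)) ℂ)
    (hcol : ∀ j : Fin k, M *ᵥ Pi.single j.castSucc 1 =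
      beta k δ (j + 1) • (Pi.single j.succ 1 : Fin (k + 1) → ℂ))
    (hone : M *ᵥ (fun _ => 1) = fun _ => 1) : M = coxeterMatrix k δ := by
  have hent : ∀ i (j : Fin k), M i j.castSucc = if i = j.succ then beta k δ (j + 1) else 0 := by
    intro i j
    have := congrFun (hcol j) i
    rw [Matrix.mulVec_single_one] at this
    rw [show M i j.castSucc = M.col j.castSucc i from rfl, this]
    simp [Pi.single_apply]
  have hlast : ∀ i, M i (Fin.last k) = if i = 0 then 1 else 1 - beta k δ i := by
    intro i
    have := congrFun hone i
    simp only [Matrix.mulVec, dotProduct, mul_one] at this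
    rw [Fin.sum_univ_castSucc, Finset.sum_congr rfl fun j _ => hent i j] at this
    induction i using Fin.cases with
    | zero => simpa [(Fin.succ_ne_zero _).symm] using this
    | succ i =>
      simp only [Fin.succ_inj, Finset.sum_ite_eq, Finset.mem_univ, if_true] at this
      rw [if_neg (Fin.succ_ne_zero i), Fin.val_succ]
      linear_combination this
  ext i j
  rw [coxeterMatrix, Matrix.of_apply]
  induction j using Fin.lastCases with
  | last =>
    have : (i : ℕ) ≠ k + 1 := i.2.ne
    rw [hlast]
    simp [this]
  | cast j =>
    rw [hent]
    simp only [Fin.ext_iff, Fin.val_succ, Fin.val_castSucc, Fin.val_last, j.2.ne, if_false,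
      add_zero]
    split_ifs with h
    · rw [h]
    · rfl

theorem smul_onesPoint_eq_iff {k : ℕ} (A : GL (Fin (k + 1)) ℂ) :
    A • onesPoint k = gamma k OnePoint.infty ↔
      ∃ d : ℂ, d • (Pi.single (Fin.last k) 1 : Fin (k + 1) → ℂ) = A • fun _ => 1 :=
  Projectivization.mk_eq_mk_iff' ..

theorem mainTheorem2 (k n : ℕ) (hk : 2 ≤ k) (hn : 1 ≤ n) (δ τ : ℂ)
    (hδ : ∀ m : ℕ, 1 ≤ m → δ ^ m ≠ 1)
    (S T : GL (Fin (k + 1)) ℂ) (hfix : ProperlyFixes S T δ τ)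
    (horb : HasOrbitData S T (coxeterLengths k n) (finRotate (k + 1))) :
    (δ ^ (n + k) - 1) * (δ ^ 2 - 1) - δ * (δ ^ (k + 1) - 1) * (δ ^ (n - 1) - 1) = 0 ∧
    (∃ S' T' L : GL (Fin (k + 1)) ℂ,
      basicCremona S' T' = basicCremona S T ∧
      (∀ j, S' • basePoint k j = S • basePoint k j) ∧
      (∀ j, T' • basePoint k j = T • basePoint k j) ∧
      S' • onesPoint k = gamma k OnePoint.infty ∧
      T' • onesPoint k = gamma k OnePoint.infty ∧
      L = T'⁻¹ * S' ∧
      (L : Matrix (Fin (k + 1)) (Fin (k + 1)) ℂ) = coxeterMatrix k δ ∧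
      linConj T' (basicCremona S T) = basicCremona L 1) ∧
    (T • onesPoint k = gamma k OnePoint.infty →
      S • onesPoint k = gamma k OnePoint.infty ∧
      ∃ c : ℂ, c ≠ 0 ∧
        ((T⁻¹ * S : GL (Fin (k + 1)) ℂ) : Matrix (Fin (k + 1)) (Fin (k + 1)) ℂ) =
          c • coxeterMatrix k δ) := by
  have hδ0 := hfix.multiplier_ne_zero
  have hδ1 : δ ≠ 1 := by simpa using hδ 1 le_rfl
  choose p hp using hfix.centered
  obtain ⟨c, hX, hTinv, hTone⟩ := exists_diagGL_normalization hk T p hp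
  have hF₁ : basicCremona (S * diagGL fun i => (c i)⁻¹) (T * diagGL c) = basicCremona S T :=
    basicCremona_mul_diagGL S T c _ 1 fun i => by simp
  obtain ⟨a, ha, hY, hSone, hτ⟩ := smul_yVec_eq hk (S * diagGL fun i => (c i)⁻¹) p δ τ hδ0
    fun t ht => smul_yVec_of_restrict hk _ (T * diagGL c) p δ τ hTinv
      (by rw [hF₁]; exact hfix.restrict) t ht
  obtain ⟨s, hs⟩ : ∃ s, ∑ j, p j = s := ⟨_, rfl⟩
  -- `s` is a factor of the nonzero number `x_0(p_0)`.
  have hs0 : s ≠ 0 := by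
    rintro rfl
    refine hX 0 ?_
    rw [xVec_self]
    exact Finset.prod_eq_zero (Finset.mem_univ 0) (by simp [hs])
  -- The scalar `b` makes `S'` send the vector `(1,…,1)` exactly to `e_k`, as `T'` does, so that
  -- `T'⁻¹S'` fixes it with no stray factor.
  have hab : (a * δ ^ (k + 1))⁻¹ ≠ 0 := inv_ne_zero (mul_ne_zero ha (pow_ne_zero _ hδ0))
  obtain ⟨b, hb⟩ : ∃ b : ℂˣ, (b : ℂ) = (a * δ ^ (k + 1))⁻¹ := ⟨Units.mk0 _ hab, rfl⟩
  have hba : (b : ℂ) * a * δ ^ (k + 1) = 1 := by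
    rw [hb, mul_assoc, inv_mul_cancel₀ (mul_ne_zero ha (pow_ne_zero _ hδ0))]
  obtain ⟨T', hT'⟩ : ∃ T', T' = T * diagGL c := ⟨_, rfl⟩
  obtain ⟨S', hS'⟩ : ∃ S', S' = S * diagGL fun i => b * (c i)⁻¹ := ⟨_, rfl⟩
  have hS'smul : ∀ v : Fin (k + 1) → ℂ,
      S' • v = (b : ℂ) • ((S * diagGL fun i => (c i)⁻¹) • v) := fun v => by
    rw [hS', mul_smul, diagGL_mul_left, gl_smul_smul_comm, mul_smul]
  have hF : basicCremona S' T' = basicCremona S T := by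
    rw [hS', hT']
    exact basicCremona_mul_diagGL S T c _ b fun i => by simp
  have hS'one : S' • (fun _ => 1) = (Pi.single (Fin.last k) 1 : Fin (k + 1) → ℂ) := by
    rw [hS'smul, hSone, smul_smul, ← mul_assoc, hba, one_smul]
  rw [← hT'] at hTinv hTone
  have hT'col : ∀ j, gammaVec k (p j) =
      xVec p (p j) j • (T' • (Pi.single j 1 : Fin (k + 1) → ℂ)) := fun j => by
    rw [← gl_smul_smul_comm, ← xVec_self_eq_smul, ← hTinv, smul_inv_smul]
  have hS'col : ∀ j, (b * a) • gammaVec k (δ * (p j - s) + τ) =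
      -xVec p (p j) j • (S' • (Pi.single j 1 : Fin (k + 1) → ℂ)) := fun j => by
    rw [← gl_smul_smul_comm, ← yVec_self_eq_smul, hs, hS'smul, hY, smul_smul]
  have hS'base : ∀ j, S' • basePoint k j = S • basePoint k j := fun j => by
    rw [hS', smul_diagGL_smul_basePoint]
  have hT'base : ∀ j, T' • basePoint k j = T • basePoint k j := fun j => by
    rw [hT', smul_diagGL_smul_basePoint]
  have hSbase : ∀ j, S • basePoint k j = gamma k ((δ * (p j - s) + τ : ℂ) : OnePoint ℂ) := by
    intro j
    rw [← hS'base, basePoint, Projectivization.smul_mk]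
    refine ((Projectivization.mk_eq_mk_iff' ..).2 ⟨(b * a)⁻¹ * -xVec p (p j) j, ?_⟩).symm
    rw [mul_smul, ← hS'col, inv_smul_smul₀ (mul_ne_zero b.ne_zero ha)]
  have hrec : ∀ i : Fin k, p i.succ = δ * (p i.castSucc - s) + τ := by
    intro i
    have h1 := (horb i.castSucc).2.2
    rw [coxeterLengths, if_neg (Fin.castSucc_lt_last i).ne, hSbase] at h1
    have h2 := mem_partialIterate_gamma hfix _ _ _ h1
    rw [hp] at h2
    have h3 : finRotate (k + 1) i.castSucc = i.succ := by
      rw [finRotate_apply]; exact Fin.coeSucc_eq_succ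
    rw [← h3]
    exact gamma_coe_injective hk h2
  have hlastorb : (fun t => δ * t + τ)^[n - 1] (δ * (p (Fin.last k) - s) + τ) = p 0 := by
    have h1 := (horb (Fin.last k)).2.2
    rw [coxeterLengths, if_pos rfl, hSbase] at h1
    have h2 := mem_partialIterate_gamma hfix _ _ _ h1
    rw [hp, finRotate_last] at h2
    exact (gamma_coe_injective hk h2).symm
  obtain ⟨A, B, hA, hB, hpAB⟩ := orbit_parameters δ τ s hδ1 (hδ _ (by omega)) p hs
    (by rw [hτ, hs]) hrec
  -- `A = 0` would force `δ = -1`.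
  have hA0 : A ≠ 0 := by
    rintro rfl
    rw [zero_mul] at hA
    have h1 : δ + 1 = 0 := (mul_eq_zero.1 hA.symm).resolve_left (neg_ne_zero.2 hs0)
    exact hδ 2 (by norm_num) (by linear_combination (δ - 1) * h1)
  have hcol : ∀ j : Fin k, S' • (Pi.single j.castSucc 1 : Fin (k + 1) → ℂ) =
      beta k δ (j + 1) • (T' • (Pi.single j.succ 1 : Fin (k + 1) → ℂ)) := by
    intro j
    have hne : δ ^ (k + 1) ≠ δ ^ ((j : ℕ) + 1) := by
      intro h
      have hj := j.2
      have h1 : δ ^ (k + 1) = δ ^ (k - j) * δ ^ ((j : ℕ) + 1) := by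
        rw [← pow_add]; congr 1; omega
      rw [h1] at h
      exact hδ (k - j) (by omega) (mul_right_cancel₀ (pow_ne_zero ((j : ℕ) + 1) hδ0)
        (h.trans (one_mul _).symm))
    -- The vector `γ(p_{j+1})` is a multiple both of column `j` of `S'` and of column `j + 1` of
    -- `T'`; `xVec_ratio` compares the factors.
    have h1 := hS'col j.castSucc
    have h2 := xVec_ratio p δ A B hδ0 hA0 hpAB j hne
    rw [← hrec, hT'col, smul_smul] at h1
    refine smul_right_injective _ (neg_ne_zero.2 (hX j.castSucc)) ?_
    change -xVec p (p j.castSucc) j.castSucc • _ = -xVec p (p j.castSucc) j.castSucc • _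
    rw [← h1, smul_smul]
    congr 1
    linear_combination (-(b : ℂ) * a) * h2 -
      beta k δ (j + 1) * xVec p (p j.castSucc) j.castSucc * hba
  have hL : (T'⁻¹ * S' : GL (Fin (k + 1)) ℂ).1 = coxeterMatrix k δ := by
    refine eq_coxeterMatrix δ _ (fun j => ?_) ?_
    · rw [← gl_smul_vec, mul_smul, hcol, gl_smul_smul_comm, inv_smul_smul]
    · rw [← gl_smul_vec, mul_smul, hS'one, ← hTone, inv_smul_smul]
  refine ⟨?_, ⟨S', T', T'⁻¹ * S', hF, hS'base, hT'base, ?_, ?_, rfl, hL, ?_⟩, fun hT1 => ?_⟩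
  · have h1 := multiplier_relation (k := k) (n := n - 1) δ τ s A B (p 0) _ hs0 hA hB
      (by simpa using hpAB 0) ?_ hlastorb
    · rwa [Nat.sub_add_cancel hn] at h1
    -- The parameter of `S(e_k)` is the next term of the progression, with exponent `k + 1`.
    · rw [hpAB, Fin.val_last, pow_succ]
      linear_combination hB
  · exact (smul_onesPoint_eq_iff _).2 ⟨1, by rw [hS'one, one_smul]⟩
  · exact (smul_onesPoint_eq_iff _).2 ⟨1, by rw [hTone, one_smul]⟩
  · rw [← hF, linConj_basicCremona]
  · obtain ⟨d, hd⟩ := (smul_onesPoint_eq_iff _).1 hT1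
    -- `T` and `T'` both send `[1:⋯:1]` to the cusp, so the diagonal matrix between them preserves
    -- that line and is scalar.
    have hcd : ∀ i, (c i : ℂ)⁻¹ = d := by
      intro i
      have h1 : T'⁻¹ • (T • (fun _ : Fin (k + 1) => (1 : ℂ))) = d • fun _ => 1 := by
        rw [← hd, gl_smul_smul_comm, ← hTone, inv_smul_smul]
      rw [hT', mul_inv_rev, ← mul_smul, inv_mul_cancel_right] at h1
      have h2 := congrFun h1 i
      rw [diagGL_inv_smul_apply] at h2
      simpa using h2
    have hd0 : d ≠ 0 := by
      rw [← hcd 0]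
      exact inv_ne_zero (c 0).ne_zero
    have hbd : (b : ℂ) * d ≠ 0 := mul_ne_zero b.ne_zero hd0
    have hDS : (diagGL fun i => b * (c i)⁻¹).1 =
        ((b : ℂ) * d) • (1 : Matrix (Fin (k + 1)) (Fin (k + 1)) ℂ) := by
      rw [Matrix.smul_one_eq_diagonal]
      simp [diagGL, hcd]
    have hDT : (diagGL c).1 = d⁻¹ • (1 : Matrix (Fin (k + 1)) (Fin (k + 1)) ℂ) := by
      rw [Matrix.smul_one_eq_diagonal]
      simp only [diagGL, ← hcd 0, inv_inv]
      congr 1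
      ext i
      rw [← inv_inv (c i : ℂ), hcd, ← hcd 0, inv_inv]
    have hS'val : S'.1 = ((b : ℂ) * d) • S.1 := by
      rw [hS', Units.val_mul, hDS, Matrix.mul_smul, Matrix.mul_one]
    refine ⟨?_, d⁻¹ * (b * d)⁻¹, mul_ne_zero (inv_ne_zero hd0) (inv_ne_zero hbd), ?_⟩
    · refine (smul_onesPoint_eq_iff _).2 ⟨(b * d)⁻¹, ?_⟩
      rw [← hS'one, gl_smul_vec S', hS'val, Matrix.smul_mulVec, inv_smul_smul₀ hbd]
      rfl
    · have h1 : T⁻¹ = diagGL c * T'⁻¹ := by rw [hT']; group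
      have h2 : S.1 = ((b : ℂ) * d)⁻¹ • S'.1 := by rw [hS'val, inv_smul_smul₀ hbd]
      rw [h1, mul_assoc, Units.val_mul, hDT, Matrix.smul_mul, Matrix.one_mul, Units.val_mul, h2,
        Matrix.mul_smul, ← Units.val_mul, hL, smul_smul]
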